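/- **Setting.** Let $G=(V,E)$ be a finite network (directed, undirected or mixed) with a source $s$ and a sink $t\neq s$. Every node and every edge $x$ has a capacity $c(x)\in\mathbb N$, and every edge $e$ has a travel time $d(e)\in\mathbb N$. Initially $p\ge 1$ people are at $s$, and some $s$–$t$ path has positive capacity on all its nodes and edges. Paths are simple $s$–$t$ paths; $T(P)$ is the sum of the travel times of the edges of $P$. Paths are ordered by transit time, ties being broken by an arbitrary fixed ranking of the paths, the same for both algorithms; "shortest" refers to this order. **SSEP.** Starting with no paths, repeat while fewer than $p$ paths have been found and $t$ is reachable from $s$ in the remaining network: find the shortest path $P_{i+1}$ in the remaining network, with transit time $T_{i+1}$ and capacity $C_{i+1}$ (the minimum of the remaining capacities of all its nodes and edges). If $i\ge 1$ and $T_{i+1}>CET(S_i)$, where $S_i=\{P_1,\dots,P_i\}$ and $$CET(S_i)=\left\lceil\frac{p+\sum_{l\le i}C_lT_l}{\sum_{l\le i}C_l}\right\rceil-1,$$ stop. Otherwise add $P_{i+1}$, reduce the capacities of its nodes and edges permanently by $C_{i+1}$, and delete those whose capacity has become $0$. If $P_1,\dots,P_k$ are the paths found, send $x_i$ people along $P_i$,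 where $\sum_i x_i=p$ and $T_i+\lceil x_i/C_i\rceil-1\le CET(S_k)$ for all $i$: groups of $C_i$ people (the last one possibly smaller) leave $s$ along $P_i$ at times $0,1,2,\dots$ and travel without delay. **CCRP.** A journey along a path consists of integer arrival and departure times at its nodes; delays at nodes are allowed. It occupies each edge at the time it enters it, and each node from its arrival there until its departure ($s$ only at the departure time, $t$ only at the arrival time). While there are people left at $s$: among all journeys along which every node and edge has positive unreserved capacity at the times at which it is used, choose one with the earliest arrival time at $t$; ties are broken in favour of the earlier path in the order above, and among journeys with the same path and arrival time in favour of the latest departure from $s$. Reserve the chosen journey for a group whose size is the minimum of the number of people left and the available capacities along the journey. The evacuation time of a plan is the time at which its last group reaches $t$. **Theorem.** Both algorithms terminate with a solution that sends all $p$ people. The evacuation time of every solution given by SSEP equals $CET(S_k)$, and it is at most the evacuation time of every solution given by CCRP. -/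

import Mathlib

/-- A capacitated network with one source and one sink. Each edge `e` joins `tail e` to `head e`;
it can be traversed from `tail e` to `head e`, and also backwards if `twoWay e` holds (so directed,
undirected and mixed graphs, possibly with parallel edges, are covered). Capacities are numbers of
people per time unit, travel times are numbers of time units. -/
structure EvacNetwork (V E : Type*) where
  tail : E → V
  head : E → V
  twoWay : E → Prop
  nodeCap : V → ℕ
  edgeCap : E → ℕ
  travel : E → ℕ
  source : V
  sink : V
  source_ne_sink : source ≠ sink

namespace EvacNetwork

variable {V E : Type*}

/-- Edge `e` can be traversed from `u` to `v`. -/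
def Joins (N : EvacNetwork V E) (e : E) (u v : V) : Prop :=
  (u = N.tail e ∧ v = N.head e) ∨ (N.twoWay e ∧ u = N.head e ∧ v = N.tail e)

/-- A (simple) path from the source to the sink, given by its nodes and its edges. -/
structure Route (N : EvacNetwork V E) where
  len : ℕ
  node : Fin (len + 1) → V
  edge : Fin len → E
  node_injective : Function.Injective node
  node_zero : node 0 = N.source
  node_last : node (Fin.last len) = N.sink
  joins : ∀ i : Fin len, N.Joins (edge i) (node i.castSucc) (node i.succ)

variable {N : EvacNetwork V E}

/-- The transit time `T(P)`. -/
def Route.transit (P : N.Route) : ℕ := ∑ i, N.travel (P.edge i)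

/-- The time needed to reach the `i`-th node of `P` without delay. -/
def Route.elapsed (P : N.Route) (i : Fin (P.len + 1)) : ℕ :=
  ∑ j : Fin P.len with j.castSucc < i, N.travel (P.edge j)

/-! ### The SSEP algorithm -/

/-- The paths found so far, in order of discovery, each with its capacity at discovery. -/
abbrev RouteList (N : EvacNetwork V E) := List (N.Route × ℕ)

open Classical in
/-- Remaining capacity of a node after the permanent reductions along the paths of `R`. -/
noncomputable def nodeLeft (R : N.RouteList) (v : V) : ℕ :=
  N.nodeCap v - (R.map fun q => if ∃ i, q.1.node i = v then q.2 else 0).sum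

open Classical in
/-- Remaining capacity of an edge after the permanent reductions along the paths of `R`. -/
noncomputable def edgeLeft (R : N.RouteList) (e : E) : ℕ :=
  N.edgeCap e - (R.map fun q => if ∃ i, q.1.edge i = e then q.2 else 0).sum

/-- The capacity of a path in the network that remains after `R`: the minimum of the remaining
capacities of its nodes and edges. -/
noncomputable def routeCap (R : N.RouteList) (P : N.Route) : ℕ :=
  sInf ({c | ∃ i, c = nodeLeft R (P.node i)} ∪ {c | ∃ i, c = edgeLeft R (P.edge i)})

/-- Shortest-path priority: smaller transit time first, ties broken by the fixed ranking. -/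
def routeKey (rank : N.Route → ℕ) (P : N.Route) : ℕ ×ₗ ℕ :=
  toLex (P.transit, rank P)

/-- `P` is the shortest path in the graph that remains after `R`. The saturated nodes and edges of
a path are those whose capacity drops to `0` when the path is added, so a path avoids all deleted
nodes and edges exactly when its remaining capacity is positive. -/
def IsShortest (rank : N.Route → ℕ) (R : N.RouteList) (P : N.Route) : Prop :=
  0 < routeCap R P ∧ ∀ Q : N.Route, 0 < routeCap R Q → routeKey rank P ≤ routeKey rank Q

/-- The combined evacuation time of `p` people on the paths of `R`. -/
def cet (p : ℕ) (R : N.RouteList) : ℤ :=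
  ⌈((p : ℚ) + (R.map fun q => (q.2 : ℚ) * q.1.transit).sum) / (R.map fun q => (q.2 : ℚ)).sum⌉ - 1

/-- The values of the route list during the main loop of SSEP. The initial value `∞` of `CET` is
accounted for by the alternative `R = []`. -/
inductive SSEPReaches (rank : N.Route → ℕ) (p : ℕ) : N.RouteList → Prop
  | init : SSEPReaches rank p []
  | add (R : N.RouteList) (P : N.Route) (hR : SSEPReaches rank p R) (hp : R.length < p)
      (hP : IsShortest rank R P) (hT : R = [] ∨ (P.transit : ℤ) ≤ cet p R) :
      SSEPReaches rank p (R ++ [(P, routeCap R P)])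

/-- The main loop of SSEP stops: `p` paths are found, or the sink is no longer reachable, or the
transit time of the next path exceeds `CET`. -/
def SSEPStops (rank : N.Route → ℕ) (p : ℕ) (R : N.RouteList) : Prop :=
  p ≤ R.length ∨ (¬ ∃ P : N.Route, 0 < routeCap R P) ∨
    ∃ P, IsShortest rank R P ∧ R ≠ [] ∧ cet p R < P.transit

/-- The number of groups in which `x` people travel along a path of capacity `c`. -/
def numGroups (x c : ℕ) : ℕ := ⌈(x : ℚ) / c⌉₊

/-- A solution of SSEP: the routes found by the main loop, together with the numbers `x i` of
people sent along them, all of whom arrive by the time `CET`. -/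
structure IsSSEPSolution (rank : N.Route → ℕ) (p : ℕ) (R : N.RouteList)
    (x : Fin R.length → ℕ) : Prop where
  reaches : SSEPReaches rank p R
  stops : SSEPStops rank p R
  sum_eq : ∑ i, x i = p
  time_le : ∀ i, ((R.get i).1.transit : ℤ) + numGroups (x i) (R.get i).2 - 1 ≤ cet p R

/-! ### Evacuation plans -/

/-- A journey from the source to the sink along a path, with arrival and departure times at its
nodes. Delays at nodes are allowed; a journey starts when it leaves the source and ends when it
reaches the sink. -/
structure Trip (N : EvacNetwork V E) where
  route : N.Route
  arr : Fin (route.len + 1) → ℕ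
  dep : Fin (route.len + 1) → ℕ
  arr_le_dep : ∀ i, arr i ≤ dep i
  dep_zero : dep 0 = arr 0
  dep_last : dep (Fin.last route.len) = arr (Fin.last route.len)
  move : ∀ i : Fin route.len, arr i.succ = dep i.castSucc + N.travel (route.edge i)

/-- The time at which a journey leaves the source. -/
def Trip.start (x : N.Trip) : ℕ := x.dep 0

/-- The destination arrival time of a journey. -/
def Trip.arrival (x : N.Trip) : ℕ := x.arr (Fin.last x.route.len)

/-- The journey along `P` that leaves the source at time `δ` and is never delayed on the way. -/
def Route.direct (P : N.Route) (δ : ℕ) : N.Trip where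
  route := P
  arr i := δ + P.elapsed i
  dep i := δ + P.elapsed i
  arr_le_dep _ := le_rfl
  dep_zero := rfl
  dep_last := rfl
  move i := by
    have h : (Finset.univ.filter fun j : Fin P.len => j.castSucc < i.succ) =
        insert i (Finset.univ.filter fun j : Fin P.len => j.castSucc < i.castSucc) := by
      ext j
      simp only [Finset.mem_filter, Finset.mem_univ, true_and, Finset.mem_insert, Fin.lt_def,
        Fin.ext_iff, Fin.val_castSucc, Fin.val_succ]
      omega
    have h' : P.elapsed i.succ = N.travel (P.edge i) + P.elapsed i.castSucc := by
      unfold Route.elapsed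
      rw [h, Finset.sum_insert (by simp)]
    rw [h']
    omega

/-- An evacuation plan: journeys with the sizes of the groups that make them. -/
abbrev Plan (N : EvacNetwork V E) := List (N.Trip × ℕ)

/-- The number of people who travel in a plan. -/
def Plan.people (L : N.Plan) : ℕ := (L.map fun q => q.2).sum

/-- The evacuation time of a plan: the time at which its last group arrives. -/
def Plan.evacTime (L : N.Plan) : ℕ := (L.map fun q => q.1.arrival).foldr max 0

/-- The plan of an SSEP solution: along the `i`-th path, of capacity `c`, groups of `c` people
(the last one possibly smaller) leave at the times `0, 1, 2, …` until `x i` people are sent. -/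
def ssepPlan (R : N.RouteList) (x : Fin R.length → ℕ) : N.Plan :=
  (List.finRange R.length).flatMap fun i =>
    (List.range (numGroups (x i) (R.get i).2)).map fun j =>
      ((R.get i).1.direct j, min (R.get i).2 (x i - j * (R.get i).2))

/-! ### The CCRP algorithm -/

open Classical in
/-- Capacity of node `v` not reserved at time `τ`. A journey occupies a node from its arrival
there to its departure. -/
noncomputable def nodeFree (L : N.Plan) (v : V) (τ : ℕ) : ℕ :=
  N.nodeCap v -
    (L.map fun q => if ∃ i, q.1.route.node i = v ∧ q.1.arr i ≤ τ ∧ τ ≤ q.1.dep i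
      then q.2 else 0).sum

open Classical in
/-- Capacity of edge `e` not reserved by groups that enter it at time `τ`. -/
noncomputable def edgeFree (L : N.Plan) (e : E) (τ : ℕ) : ℕ :=
  N.edgeCap e -
    (L.map fun q => if ∃ i : Fin q.1.route.len, q.1.route.edge i = e ∧ q.1.dep i.castSucc = τ
      then q.2 else 0).sum

/-- The capacity available for a journey, given the reservations of `L`. -/
noncomputable def tripCap (L : N.Plan) (x : N.Trip) : ℕ :=
  sInf ({c | ∃ i τ, x.arr i ≤ τ ∧ τ ≤ x.dep i ∧ c = nodeFree L (x.route.node i) τ} ∪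
    {c | ∃ i : Fin x.route.len, c = edgeFree L (x.route.edge i) (x.dep i.castSucc)})

/-- CCRP looks for the earliest destination arrival time. Ties are broken by the priority of the
paths (transit time, then ranking), and then in favour of waiting at the source rather than on
the way. -/
def tripKey (rank : N.Route → ℕ) (x : N.Trip) : ℕ ×ₗ (ℕ ×ₗ ℕ) ×ₗ ℕ :=
  toLex (x.arrival, toLex (routeKey rank x.route, x.arrival - x.start))

/-- `x` is the journey selected by CCRP, given the reservations of `L`. -/
def IsCCRPChoice (rank : N.Route → ℕ) (L : N.Plan) (x : N.Trip) : Prop :=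
  0 < tripCap L x ∧ ∀ y : N.Trip, 0 < tripCap L y → tripKey rank x ≤ tripKey rank y

/-- The reservations made during a run of CCRP for `p` people. -/
inductive CCRPReaches (rank : N.Route → ℕ) (p : ℕ) : N.Plan → Prop
  | init : CCRPReaches rank p []
  | reserve (L : N.Plan) (x : N.Trip) (hL : CCRPReaches rank p L) (hp : L.people < p)
      (hx : IsCCRPChoice rank L x) :
      CCRPReaches rank p (L ++ [(x, min (p - L.people) (tripCap L x))])

/-- A solution of CCRP: a run after which nobody is left at the source. -/
def IsCCRPSolution (rank : N.Route → ℕ) (p : ℕ) (L : N.Plan) : Prop :=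
  CCRPReaches rank p L ∧ L.people = p

end EvacNetwork

namespace EvacNetwork

variable {V E : Type*} {N : EvacNetwork V E}

/-! ### Elapsed times -/

/-! Extend the paths found by SSEP to a complete greedy list `G` of successive shortest paths, which
cuts the sink off. A slot is a pair (arrival time σ, path `l` of `G`) with T_l ≤ σ. CCRP fills the
slots in lexicographic order, each with an undelayed group of size C_l; only its final group may be
smaller (`Follows.isCCRPChoice_iff`, `CCRPReaches.exists_follows`). The reason is an exchange
argument: a shortest path reaches each of its nodes and edges as early, and leads on to the sink as
fast, as any competing path (`IsShortest.uses_le`). Hence the capacity free at a given moment agrees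
with the static remaining capacity of SSEP where it matters (`Follows.free_le_left`,
`Follows.left_le_free`).

Counting slots, a CCRP solution with evacuation time z satisfies p ≤ Σ C_l (z + 1 - T_l)⁺ over `G`.
On the other hand, CET is the least integer z with p ≤ Σ C_l (z + 1 - T_l) over the paths of SSEP
(`cet_le_iff`). These paths have T ≤ CET and the rest of `G` has T ≥ CET
(`SSEPReaches.transit_le_cet`, `SSEPStops.cet_le_transit`), so z < CET would contradict minimality.
The same minimality shows that SSEP needs exactly CET. -/

theorem Route.elapsed_zero (P : N.Route) : P.elapsed 0 = 0 := by
  simp [Route.elapsed]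

theorem Route.elapsed_succ (P : N.Route) (i : Fin P.len) :
    P.elapsed i.succ = P.elapsed i.castSucc + N.travel (P.edge i) := by
  simpa [Route.direct] using (P.direct 0).move i

theorem Route.elapsed_last (P : N.Route) : P.elapsed (Fin.last P.len) = P.transit := by
  simp [Route.elapsed, Route.transit, Fin.castSucc_lt_last]

theorem Trip.start_add_elapsed_le_arr (x : N.Trip) (i : Fin (x.route.len + 1)) :
    x.start + x.route.elapsed i ≤ x.arr i := by
  induction i using Fin.induction with
  | zero => simp [Route.elapsed_zero, Trip.start, x.dep_zero]
  | succ i ih =>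
    have := x.arr_le_dep i.castSucc
    rw [x.move, Route.elapsed_succ]
    omega

theorem Trip.dep_add_transit_le (x : N.Trip) (i : Fin (x.route.len + 1)) :
    x.dep i + x.route.transit ≤ x.arrival + x.route.elapsed i := by
  induction i using Fin.reverseInduction with
  | last => rw [x.dep_last, Route.elapsed_last, Trip.arrival]
  | cast i ih =>
    have := x.arr_le_dep i.succ
    rw [x.move] at this
    rw [Route.elapsed_succ] at ih
    omega

theorem Trip.start_add_transit_le (x : N.Trip) : x.start + x.route.transit ≤ x.arrival := by
  simpa [Route.elapsed_zero, Trip.start] using x.dep_add_transit_le 0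

theorem Route.direct_start (P : N.Route) (δ : ℕ) : (P.direct δ).start = δ := by
  change δ + P.elapsed 0 = δ
  rw [P.elapsed_zero, add_zero]

theorem Route.direct_arrival (P : N.Route) (δ : ℕ) :
    (P.direct δ).arrival = δ + P.transit := by
  simp [Trip.arrival, Route.direct, Route.elapsed_last]

/-- A journey whose duration is at most the transit time of its path is never delayed. -/
theorem Trip.eq_direct (x : N.Trip) (h : x.arrival ≤ x.start + x.route.transit) :
    x = x.route.direct x.start := by
  have harr : x.arr = fun i => x.start + x.route.elapsed i := by
    funext i
    have := x.start_add_elapsed_le_arr i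
    have := x.dep_add_transit_le i
    have := x.arr_le_dep i
    omega
  have hdep : x.dep = fun i => x.start + x.route.elapsed i := by
    funext i
    have := x.start_add_elapsed_le_arr i
    have := x.dep_add_transit_le i
    have := x.arr_le_dep i
    omega
  generalize x.start = δ at harr hdep
  obtain ⟨P, arr, dep, _, _, _, _⟩ := x
  dsimp only at harr hdep
  subst harr hdep
  rfl

/-! ### Walks and shortcuts -/

/-- There is a walk from `u` to `v` with `n` edges and total travel time `c` that uses only nodes
satisfying `A` and edges satisfying `B`. -/
inductive HasWalk (N : EvacNetwork V E) (A : V → Prop) (B : E → Prop) : V → V → ℕ → ℕ → Prop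
  | nil (v : V) (hv : A v) : HasWalk N A B v v 0 0
  | cons (u v w : V) (e : E) (n c : ℕ) (hu : A u) (he : B e) (hj : N.Joins e u v)
      (h : HasWalk N A B v w n c) : HasWalk N A B u w (n + 1) (N.travel e + c)

section Walk

variable {A : V → Prop} {B : E → Prop}

theorem HasWalk.trans {u v w : V} {n n' c c' : ℕ} (h : HasWalk N A B u v n c)
    (h' : HasWalk N A B v w n' c') : HasWalk N A B u w (n + n') (c + c') := by
  induction h with
  | nil v hv => simpa using h'
  | cons u v w e n c hu he hj _ ih =>
    have := HasWalk.cons u v _ e _ _ hu he hj (ih h')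
    rwa [← add_assoc, add_right_comm n n' 1] at this

theorem HasWalk.snoc {u v w : V} {e : E} {n c : ℕ} (h : HasWalk N A B u v n c)
    (hw : A w) (hv : A v) (he : B e) (hj : N.Joins e v w) :
    HasWalk N A B u w (n + 1) (c + N.travel e) :=
  h.trans (by simpa using HasWalk.cons v w w e 0 0 hv he hj (HasWalk.nil w hw))

theorem hasWalk_segment {f : ℕ → V} {g : ℕ → E} {n : ℕ} (hA : ∀ k ≤ n, A (f k))
    (hB : ∀ k < n, B (g k)) (hj : ∀ k < n, N.Joins (g k) (f k) (f (k + 1))) {i j : ℕ}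
    (hij : i ≤ j) (hjn : j ≤ n) :
    HasWalk N A B (f i) (f j) (j - i) (∑ k ∈ Finset.Ico i j, N.travel (g k)) := by
  induction j, hij using Nat.le_induction with
  | base => simpa using HasWalk.nil _ (hA i hjn)
  | succ j hij ih =>
    rw [Finset.sum_Ico_succ_top hij, Nat.succ_sub hij]
    exact (ih (by omega)).snoc (hA _ hjn) (hA _ (by omega)) (hB _ (by omega)) (hj _ (by omega))

theorem HasWalk.nonempty_edge {u v : V} {n c : ℕ} (h : HasWalk N A B u v n c) (huv : u ≠ v) :
    Nonempty E := by
  cases h with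
  | nil => exact absurd rfl huv
  | cons _ _ _ e => exact ⟨e⟩

/-- Indexing by ℕ instead of `Fin` lets segments be cut out without casts; values past the end are
junk, hence `Nonempty E`. -/
theorem HasWalk.exists_fun [Nonempty E] {u v : V} {n c : ℕ} (h : HasWalk N A B u v n c) :
    ∃ (f : ℕ → V) (g : ℕ → E), f 0 = u ∧ f n = v ∧ (∀ k ≤ n, A (f k)) ∧
      (∀ k < n, B (g k)) ∧ (∀ k < n, N.Joins (g k) (f k) (f (k + 1))) ∧
        ∑ k ∈ Finset.range n, N.travel (g k) = c := by
  induction h with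
  | nil v hv => exact ⟨fun _ => v, fun _ => Classical.arbitrary E, rfl, rfl, fun _ _ => hv, by simp⟩
  | cons u v w e n c hu he hj _ ih =>
    obtain ⟨f, g, h0, hn, hA, hB, hJ, hc⟩ := ih
    refine ⟨fun k => k.casesOn u f, fun k => k.casesOn e g, rfl, hn, ?_, ?_, ?_, ?_⟩
    · rintro (_ | k) hk
      · exact hu
      · exact hA k (by omega)
    · rintro (_ | k) hk
      · exact he
      · exact hB k (by omega)
    · rintro (_ | k) hk
      · simpa [h0] using hj
      · exact hJ k (by omega)
    · rw [Finset.sum_range_succ']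
      simp [hc, add_comm]

/-- A walk from the source to the sink can be shortened to a simple path. -/
theorem HasWalk.exists_route {n c : ℕ} (h : HasWalk N A B N.source N.sink n c) :
    ∃ Q : N.Route, (∀ i, A (Q.node i)) ∧ (∀ i, B (Q.edge i)) ∧ Q.transit ≤ c := by
  induction n using Nat.strong_induction_on generalizing c with
  | _ n ih =>
  have := h.nonempty_edge N.source_ne_sink
  obtain ⟨f, g, h0, hn, hA, hB, hJ, hc⟩ := h.exists_fun
  by_cases hinj : ∀ i j, i < j → j ≤ n → f i ≠ f j
  · have hinj' : Function.Injective fun i : Fin (n + 1) => f i := by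
      intro i j hij
      rcases lt_trichotomy i.val j.val with hlt | heq | hlt
      · exact absurd hij (hinj _ _ hlt (by omega))
      · exact Fin.ext heq
      · exact absurd hij.symm (hinj _ _ hlt (by omega))
    refine ⟨⟨n, fun i => f i, fun i => g i, hinj', h0, hn, fun i => hJ i i.2⟩,
      fun i => hA i (Nat.lt_succ_iff.1 i.2), fun i => hB i i.2, ?_⟩
    rw [Route.transit, ← hc, Finset.sum_range]
  -- A repeated node: dropping the closed part between `i` and `j` leaves fewer edges and no larger
  -- travel time.
  · push Not at hinj
    obtain ⟨i, j, hij, hjn, hf⟩ := hinj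
    have w₁ := hasWalk_segment hA hB hJ (Nat.zero_le i) (by omega)
    have w₂ := hasWalk_segment hA hB hJ hjn le_rfl
    rw [← hf] at w₂
    have w := w₁.trans w₂
    rw [h0, hn] at w
    obtain ⟨Q, hQA, hQB, hQ⟩ := ih _ (by omega) w
    refine ⟨Q, hQA, hQB, hQ.trans ?_⟩
    have h₁ := Finset.sum_Ico_consecutive (fun k => N.travel (g k)) (Nat.zero_le i) hij.le
    have h₂ := Finset.sum_Ico_consecutive (fun k => N.travel (g k)) (Nat.zero_le j) hjn
    rw [← hc, Finset.range_eq_Ico]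
    omega

theorem Route.hasWalk_prefix (P : N.Route) (hA : ∀ i, A (P.node i)) (hB : ∀ i, B (P.edge i))
    (i : Fin (P.len + 1)) : ∃ n, HasWalk N A B N.source (P.node i) n (P.elapsed i) := by
  induction i using Fin.induction with
  | zero =>
    have h := hA 0
    rw [P.elapsed_zero, P.node_zero]
    rw [P.node_zero] at h
    exact ⟨0, .nil _ h⟩
  | succ i ih =>
    obtain ⟨n, h⟩ := ih
    exact ⟨n + 1, P.elapsed_succ i ▸ h.snoc (hA _) (hA _) (hB i) (P.joins i)⟩

theorem Route.hasWalk_suffix (P : N.Route) (hA : ∀ i, A (P.node i)) (hB : ∀ i, B (P.edge i))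
    (i : Fin (P.len + 1)) :
    ∃ n c, P.elapsed i + c = P.transit ∧ HasWalk N A B (P.node i) N.sink n c := by
  induction i using Fin.reverseInduction with
  | last =>
    have h := hA (Fin.last _)
    rw [P.node_last] at h ⊢
    exact ⟨0, 0, P.elapsed_last, .nil _ h⟩
  | cast i ih =>
    obtain ⟨n, c, hc, h⟩ := ih
    refine ⟨n + 1, _, ?_, .cons _ _ _ _ _ _ (hA _) (hB i) (P.joins i) h⟩
    rw [← hc, P.elapsed_succ, add_assoc]

/-- A path can be left at a common node in order to continue along another one. -/
theorem Route.exists_splice (P Q : N.Route) (hPA : ∀ i, A (P.node i)) (hPB : ∀ i, B (P.edge i))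
    (hQA : ∀ i, A (Q.node i)) (hQB : ∀ i, B (Q.edge i)) {i : Fin (P.len + 1)}
    {j : Fin (Q.len + 1)} (hij : P.node i = Q.node j) :
    ∃ W : N.Route, (∀ i, A (W.node i)) ∧ (∀ i, B (W.edge i)) ∧
      W.transit + Q.elapsed j ≤ P.elapsed i + Q.transit := by
  obtain ⟨n, h⟩ := P.hasWalk_prefix hPA hPB i
  obtain ⟨n', c, hc, h'⟩ := Q.hasWalk_suffix hQA hQB j
  rw [hij] at h
  obtain ⟨W, hWA, hWB, hW⟩ := (h.trans h').exists_route
  exact ⟨W, hWA, hWB, by omega⟩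

end Walk

/-! ### Resources: nodes and edges treated alike -/

/-- Path `P` passes the node or enters the edge `r` when it has travelled for time `t`. -/
def Route.Uses (P : N.Route) : V ⊕ E → ℕ → Prop
  | .inl v, t => ∃ i, P.node i = v ∧ P.elapsed i = t
  | .inr e, t => ∃ i : Fin P.len, P.edge i = e ∧ P.elapsed i.castSucc = t

/-- Journey `x` occupies the node or edge `r` at time `θ`. -/
def Trip.Occupies (x : N.Trip) : V ⊕ E → ℕ → Prop
  | .inl v, θ => ∃ i, x.route.node i = v ∧ x.arr i ≤ θ ∧ θ ≤ x.dep i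
  | .inr e, θ => ∃ i : Fin x.route.len, x.route.edge i = e ∧ x.dep i.castSucc = θ

/-- The capacity of a node or edge. -/
def cap (N : EvacNetwork V E) : V ⊕ E → ℕ := Sum.elim N.nodeCap N.edgeCap

/-- Remaining capacity of a node or edge after the reductions along the paths of `R`. -/
noncomputable def left (R : N.RouteList) : V ⊕ E → ℕ := Sum.elim (nodeLeft R) (edgeLeft R)

/-- Capacity of a node or edge not reserved at time `θ`. -/
noncomputable def free (L : N.Plan) (r : V ⊕ E) (θ : ℕ) : ℕ :=
  Sum.elim (fun v => nodeFree L v θ) (fun e => edgeFree L e θ) r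

open Classical in
theorem left_eq (R : N.RouteList) (r : V ⊕ E) :
    left R r = N.cap r - (R.map fun q => if ∃ t, q.1.Uses r t then q.2 else 0).sum := by
  cases r <;> simp [left, nodeLeft, edgeLeft, cap, Route.Uses]

open Classical in
theorem free_eq (L : N.Plan) (r : V ⊕ E) (θ : ℕ) :
    free L r θ = N.cap r - (L.map fun q => if q.1.Occupies r θ then q.2 else 0).sum := by
  cases r <;> (rw [free, cap]; first | rw [Sum.elim_inl, nodeFree] | rw [Sum.elim_inr, edgeFree]) <;>
    congr!

theorem routeCap_eq (R : N.RouteList) (P : N.Route) :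
    routeCap R P = sInf {c | ∃ r t, P.Uses r t ∧ c = left R r} := by
  rw [routeCap]
  congr 1
  ext c
  constructor
  · rintro (⟨i, h⟩ | ⟨i, h⟩)
    · exact ⟨.inl _, _, ⟨i, rfl, rfl⟩, h⟩
    · exact ⟨.inr _, _, ⟨i, rfl, rfl⟩, h⟩
  · rintro ⟨v | e, t, ⟨i, rfl, -⟩, h⟩
    · exact .inl ⟨i, h⟩
    · exact .inr ⟨i, h⟩

theorem tripCap_eq (L : N.Plan) (x : N.Trip) :
    tripCap L x = sInf {c | ∃ r θ, x.Occupies r θ ∧ c = free L r θ} := by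
  rw [tripCap]
  congr 1
  ext c
  constructor
  · rintro (⟨i, τ, h₁, h₂, h⟩ | ⟨i, h⟩)
    · exact ⟨.inl _, τ, ⟨i, rfl, h₁, h₂⟩, h⟩
    · exact ⟨.inr _, _, ⟨i, rfl, rfl⟩, h⟩
  · rintro ⟨v | e, t, hr, h⟩
    · obtain ⟨i, rfl, h₁, h₂⟩ := hr
      exact .inl ⟨i, t, h₁, h₂, h⟩
    · obtain ⟨i, rfl, rfl⟩ := hr
      exact .inr ⟨i, h⟩

theorem sInf_pos_iff_forall {s : Set ℕ} (hs : s.Nonempty) :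
    0 < sInf s ↔ ∀ c ∈ s, 0 < c :=
  ⟨fun h _ hc => h.trans_le (Nat.sInf_le hc), fun h => h _ (Nat.sInf_mem hs)⟩

theorem Route.uses_source (P : N.Route) : P.Uses (.inl N.source) 0 :=
  ⟨0, P.node_zero, P.elapsed_zero⟩

theorem routeCap_pos_iff {R : N.RouteList} {P : N.Route} :
    0 < routeCap R P ↔ ∀ r t, P.Uses r t → 0 < left R r := by
  have hne : {c | ∃ r t, P.Uses r t ∧ c = left R r}.Nonempty := ⟨_, _, _, P.uses_source, rfl⟩
  rw [routeCap_eq, sInf_pos_iff_forall hne]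
  exact ⟨fun h r t hr => h _ ⟨r, t, hr, rfl⟩, by rintro h _ ⟨r, t, hr, rfl⟩; exact h r t hr⟩

theorem routeCap_pos_iff_forall {R : N.RouteList} {P : N.Route} :
    0 < routeCap R P ↔
      (∀ i, 0 < nodeLeft R (P.node i)) ∧ ∀ i, 0 < edgeLeft R (P.edge i) := by
  rw [routeCap_pos_iff]
  constructor
  · exact fun h => ⟨fun i => h (.inl _) _ ⟨i, rfl, rfl⟩, fun i => h (.inr _) _ ⟨i, rfl, rfl⟩⟩
  · rintro ⟨h, h'⟩ (v | e) t ⟨i, rfl, -⟩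
    · exact h i
    · exact h' i

theorem free_pos_of_tripCap_pos {L : N.Plan} {x : N.Trip} (h : 0 < tripCap L x) {r : V ⊕ E}
    {θ : ℕ} (hr : x.Occupies r θ) : 0 < free L r θ := by
  rw [tripCap_eq] at h
  exact h.trans_le (Nat.sInf_le ⟨r, θ, hr, rfl⟩)

/-- Two traversals of one edge have the same ends, in equal or opposite order. Simplicity settles
the first case; the second would give i = j + 1 and j = i + 1. -/
theorem Route.edge_injective (P : N.Route) : Function.Injective P.edge := by
  intro i j hij
  have hi := P.joins i
  have hj := P.joins j
  rw [hij] at hi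
  have key : P.node i.castSucc = P.node j.castSucc ∨
      (P.node i.castSucc = P.node j.succ ∧ P.node i.succ = P.node j.castSucc) := by
    rcases hi with ⟨a, b⟩ | ⟨-, a, b⟩ <;> rcases hj with ⟨c, d⟩ | ⟨-, c, d⟩
    · exact .inl (a.trans c.symm)
    · exact .inr ⟨a.trans d.symm, b.trans c.symm⟩
    · exact .inr ⟨a.trans d.symm, b.trans c.symm⟩
    · exact .inl (a.trans c.symm)
  rcases key with h | ⟨h, h'⟩
  · exact Fin.castSucc_injective _ (P.node_injective h)
  · have h₁ := congrArg Fin.val (P.node_injective h)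
    have h₂ := congrArg Fin.val (P.node_injective h')
    simp only [Fin.val_castSucc, Fin.val_succ] at h₁ h₂
    omega

/-- By simplicity. Consequently undelayed groups on one path with different departures never occupy
the same resource simultaneously. -/
theorem Route.Uses.unique {P : N.Route} {r : V ⊕ E} {t t' : ℕ} (h : P.Uses r t)
    (h' : P.Uses r t') : t = t' := by
  cases r with
  | inl v =>
    obtain ⟨i, hi, rfl⟩ := h
    obtain ⟨j, hj, rfl⟩ := h'
    rw [P.node_injective (hi.trans hj.symm)]
  | inr e =>
    obtain ⟨i, hi, rfl⟩ := h
    obtain ⟨j, hj, rfl⟩ := h'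
    rw [P.edge_injective (hi.trans hj.symm)]

theorem Trip.Occupies.exists_uses {x : N.Trip} {r : V ⊕ E} {θ : ℕ} (h : x.Occupies r θ) :
    ∃ t, x.route.Uses r t ∧ t ≤ θ ∧ θ + x.route.transit ≤ x.arrival + t := by
  cases r with
  | inl v =>
    obtain ⟨i, hi, h₁, h₂⟩ := h
    have := x.start_add_elapsed_le_arr i
    have := x.dep_add_transit_le i
    exact ⟨_, ⟨i, hi, rfl⟩, by omega, by omega⟩
  | inr e =>
    obtain ⟨i, hi, rfl⟩ := h
    have := x.start_add_elapsed_le_arr i.castSucc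
    have := x.arr_le_dep i.castSucc
    have := x.dep_add_transit_le i.castSucc
    exact ⟨_, ⟨i, hi, rfl⟩, by omega, by omega⟩

theorem Route.direct_occupies_iff {P : N.Route} {δ : ℕ} {r : V ⊕ E} {θ : ℕ} :
    (P.direct δ).Occupies r θ ↔ ∃ t, P.Uses r t ∧ θ = δ + t := by
  cases r with
  | inl v =>
    constructor
    · rintro ⟨i, hi, h₁, h₂⟩
      exact ⟨_, ⟨i, hi, rfl⟩, le_antisymm h₂ h₁⟩
    · rintro ⟨_, ⟨i, hi, rfl⟩, rfl⟩
      exact ⟨i, hi, le_rfl, le_rfl⟩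
  | inr e =>
    constructor
    · rintro ⟨i, hi, h⟩
      exact ⟨_, ⟨i, hi, rfl⟩, h.symm⟩
    · rintro ⟨_, ⟨i, hi, rfl⟩, rfl⟩
      exact ⟨i, hi, rfl⟩

theorem IsShortest.transit_le {rank : N.Route → ℕ} {R : N.RouteList} {P Q : N.Route}
    (hP : IsShortest rank R P) (hQ : 0 < routeCap R Q) : P.transit ≤ Q.transit := by
  rcases Prod.Lex.le_iff.1 (hP.2 Q hQ) with h | h
  · exact h.le
  · exact h.1.le

/-- The shortest path in a remaining network reaches each of its nodes and edges as early, and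
leads from there to the sink as fast, as any other path in that network. -/
theorem IsShortest.uses_le {rank : N.Route → ℕ} {R : N.RouteList} {P Q : N.Route}
    (hP : IsShortest rank R P) (hQ : 0 < routeCap R Q) {r : V ⊕ E} {t t' : ℕ}
    (hr : P.Uses r t) (hr' : Q.Uses r t') :
    t ≤ t' ∧ P.transit + t' ≤ Q.transit + t := by
  obtain ⟨hPA, hPB⟩ := routeCap_pos_iff_forall.1 hP.1
  obtain ⟨hQA, hQB⟩ := routeCap_pos_iff_forall.1 hQ
  have node : ∀ i j, P.node i = Q.node j →
      P.elapsed i ≤ Q.elapsed j ∧ P.transit + Q.elapsed j ≤ Q.transit + P.elapsed i := by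
    intro i j hij
    -- `W` follows `Q` and then `P`, `W'` follows `P` and then `Q`. Both survive in the remaining
    -- network, so neither is shorter than `P`; this gives the two inequalities.
    obtain ⟨W, hWA, hWB, hW⟩ := Q.exists_splice (A := fun v => 0 < nodeLeft R v)
      (B := fun e => 0 < edgeLeft R e) P hQA hQB hPA hPB hij.symm
    obtain ⟨W', hWA', hWB', hW'⟩ := P.exists_splice (A := fun v => 0 < nodeLeft R v)
      (B := fun e => 0 < edgeLeft R e) Q hPA hPB hQA hQB hij
    have := hP.transit_le (Q := W) (routeCap_pos_iff_forall.2 ⟨hWA, hWB⟩)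
    have := hP.transit_le (Q := W') (routeCap_pos_iff_forall.2 ⟨hWA', hWB'⟩)
    omega
  cases r with
  | inl v =>
    obtain ⟨i, hi, rfl⟩ := hr
    obtain ⟨j, hj, rfl⟩ := hr'
    exact node i j (hi.trans hj.symm)
  | inr e =>
    obtain ⟨i, hi, rfl⟩ := hr
    obtain ⟨j, hj, rfl⟩ := hr'
    have jP := P.joins i
    have jQ := Q.joins j
    rw [hi] at jP
    rw [hj] at jQ
    -- For opposite traversals the first inequality comes from the node that `P` enters by the edge,
    -- the second from the node that `P` leaves by it.
    have opposite : P.node i.castSucc = Q.node j.succ → P.node i.succ = Q.node j.castSucc →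
        P.elapsed i.castSucc ≤ Q.elapsed j.castSucc ∧
          P.transit + Q.elapsed j.castSucc ≤ Q.transit + P.elapsed i.castSucc := by
      intro h h'
      have h₁ := node _ _ h
      have h₂ := node _ _ h'
      rw [Q.elapsed_succ] at h₁
      rw [P.elapsed_succ] at h₂
      omega
    rcases jP with ⟨a, b⟩ | ⟨-, a, b⟩ <;> rcases jQ with ⟨c, d⟩ | ⟨-, c, d⟩
    · exact node _ _ (a.trans c.symm)
    · exact opposite (a.trans d.symm) (b.trans c.symm)
    · exact opposite (a.trans d.symm) (b.trans c.symm)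
    · exact node _ _ (a.trans c.symm)

/-! ### Greedy lists of shortest paths -/

/-- Each path of `G` is the shortest one in the network that remains after the previous paths, and
carries its capacity in that network. -/
def IsGreedy (rank : N.Route → ℕ) (G : N.RouteList) : Prop :=
  ∀ i : Fin G.length, IsShortest rank (G.take i) (G.get i).1 ∧
    (G.get i).2 = routeCap (G.take i) (G.get i).1

/-- Rewrites reductions along a prefix as sums over path indices, to be compared with sums over
slots. -/
theorem sum_map_take {α : Type*} (G : List α) (h : α → ℕ) (n : ℕ) :
    ((G.take n).map h).sum = ∑ l : Fin G.length with l.val < n, h (G.get l) := by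
  induction G generalizing n with
  | nil => simp
  | cons a G ih =>
    rw [Finset.sum_filter]
    cases n with
    | zero => simp
    | succ n =>
      simp only [List.take_succ_cons, List.map_cons, List.sum_cons, List.length_cons,
        Fin.sum_univ_succ, ih, Finset.sum_filter]
      simp

theorem left_take_antitone (G : N.RouteList) (r : V ⊕ E) {m n : ℕ} (hmn : m ≤ n) :
    left (G.take n) r ≤ left (G.take m) r := by
  classical
  simp only [left_eq, sum_map_take]
  refine Nat.sub_le_sub_left (Finset.sum_le_sum_of_subset fun l hl => ?_) _
  simp only [Finset.mem_filter, Finset.mem_univ, true_and] at hl ⊢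
  omega

theorem routeCap_take_pos {G : N.RouteList} {P : N.Route} {m n : ℕ} (hmn : m ≤ n)
    (h : 0 < routeCap (G.take n) P) : 0 < routeCap (G.take m) P :=
  routeCap_pos_iff.2 fun r t hr =>
    (routeCap_pos_iff.1 h r t hr).trans_le (left_take_antitone G r hmn)

theorem exists_isShortest (rank : N.Route → ℕ) {R : N.RouteList}
    (h : ∃ P : N.Route, 0 < routeCap R P) : ∃ P, IsShortest rank R P := by
  obtain ⟨P, hP, hmin⟩ := (InvImage.wf (routeKey rank) wellFounded_lt).has_min
    {P : N.Route | 0 < routeCap R P} h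
  exact ⟨P, hP, fun Q hQ => not_lt.1 (hmin Q hQ)⟩

theorem isGreedy_nil (rank : N.Route → ℕ) : IsGreedy rank ([] : N.RouteList) :=
  fun i => i.elim0

theorem IsGreedy.snoc {rank : N.Route → ℕ} {G : N.RouteList} (hG : IsGreedy rank G)
    {P : N.Route} (hP : IsShortest rank G P) : IsGreedy rank (G ++ [(P, routeCap G P)]) := by
  rintro ⟨i, hi⟩
  rw [List.length_append, List.length_singleton] at hi
  rcases (Nat.lt_succ_iff.1 hi).lt_or_eq with h | rfl
  · have := hG ⟨i, h⟩
    simpa [List.take_append_of_le_length h.le, List.getElem_append_left h] using this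
  · simpa using hP

theorem IsGreedy.cap_pos {rank : N.Route → ℕ} {G : N.RouteList} (hG : IsGreedy rank G)
    (i : Fin G.length) : 0 < (G.get i).2 :=
  (hG i).2 ▸ (hG i).1.1

theorem IsGreedy.transit_mono {rank : N.Route → ℕ} {G : N.RouteList} (hG : IsGreedy rank G)
    {i j : Fin G.length} (hij : i ≤ j) : (G.get i).1.transit ≤ (G.get j).1.transit :=
  (hG i).1.transit_le (routeCap_take_pos hij (hG j).1.1)

/-- A greedy list can be continued until the sink is no longer reachable. -/
theorem IsGreedy.exists_complete {rank : N.Route → ℕ} {R : N.RouteList} (hR : IsGreedy rank R) :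
    ∃ G, R <+: G ∧ IsGreedy rank G ∧ ¬ ∃ P : N.Route, 0 < routeCap G P := by
  classical
  -- Every path uses the source, so each added path strictly lowers the capacity left there.
  induction hn : left R (.inl N.source) using Nat.strong_induction_on generalizing R with
  | _ n ih =>
  by_cases h : ∃ P : N.Route, 0 < routeCap R P
  · obtain ⟨P, hP⟩ := exists_isShortest rank h
    have hlt : left (R ++ [(P, routeCap R P)]) (.inl N.source) < n := by
      have h₁ := routeCap_pos_iff.1 hP.1 _ _ P.uses_source
      have h₂ := hP.1
      rw [← hn]
      rw [left_eq] at h₁ ⊢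
      rw [left_eq, List.map_append, List.sum_append]
      have h₃ : ∃ t, P.Uses (.inl N.source) t := ⟨_, P.uses_source⟩
      simp only [List.map_cons, List.map_nil, List.sum_singleton, if_pos h₃]
      omega
    obtain ⟨G, hG, hG'⟩ := ih _ hlt (hR.snoc hP) rfl
    exact ⟨G, (List.prefix_append _ _).trans hG, hG'⟩
  · exact ⟨R, List.prefix_rfl, hR, h⟩

/-! ### The course of CCRP -/

theorem Trip.exists_occupies {y : N.Trip} {r : V ⊕ E} {t : ℕ} (hr : y.route.Uses r t) :
    ∃ θ, y.Occupies r θ := by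
  cases r with
  | inl v =>
    obtain ⟨i, hi, -⟩ := hr
    exact ⟨_, i, hi, le_rfl, y.arr_le_dep i⟩
  | inr e =>
    obtain ⟨i, hi, -⟩ := hr
    exact ⟨_, i, hi, rfl⟩

theorem routeCap_nil_pos_of_tripCap_pos {L : N.Plan} {y : N.Trip} (hy : 0 < tripCap L y) :
    0 < routeCap [] y.route := by
  refine routeCap_pos_iff.2 fun r t hr => ?_
  obtain ⟨θ, ho⟩ := Trip.exists_occupies hr
  refine (free_pos_of_tripCap_pos hy ho).trans_le ?_
  simp [free_eq, left_eq]

/-- The pairs (arrival time, path of `G`) that precede `b` in the lexicographic order and are such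
that the path is short enough for the arrival time. -/
def slots (G : N.RouteList) (b : ℕ × Fin G.length) : Finset (ℕ × Fin G.length) :=
  {a ∈ Finset.range (b.1 + 1) ×ˢ Finset.univ |
    (G.get a.2).1.transit ≤ a.1 ∧ (a.1 < b.1 ∨ a.1 = b.1 ∧ a.2 < b.2)}

theorem mem_slots {G : N.RouteList} {a b : ℕ × Fin G.length} :
    a ∈ slots G b ↔
      (G.get a.2).1.transit ≤ a.1 ∧ (a.1 < b.1 ∨ a.1 = b.1 ∧ a.2 < b.2) := by
  simp only [slots, Finset.mem_filter, Finset.mem_product, Finset.mem_range, Finset.mem_univ,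
    and_true, and_iff_right_iff_imp]
  omega

/-- The undelayed group that fills a path of `G` and arrives at a given time. -/
def slotGroup (G : N.RouteList) (a : ℕ × Fin G.length) : N.Trip × ℕ :=
  ((G.get a.2).1.direct (a.1 - (G.get a.2).1.transit), (G.get a.2).2)

/-- The plan `L` consists, up to order, of the groups of the slots before `b`. -/
structure Follows (G : N.RouteList) (L : N.Plan) (b : ℕ × Fin G.length) : Prop where
  transit_le : (G.get b.2).1.transit ≤ b.1
  -- Testing against all weights encodes equality of multisets; suitable `g` give reserved
  -- capacities and numbers of people.
  sum_eq : ∀ g : N.Trip × ℕ → ℕ, (L.map g).sum = ∑ a ∈ slots G b, g (slotGroup G a)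

section

variable {rank : N.Route → ℕ} {G : N.RouteList} {L : N.Plan} {b : ℕ × Fin G.length}

open Classical in
theorem Follows.free_eq (h : Follows G L b) (r : V ⊕ E) (θ : ℕ) :
    free L r θ = N.cap r -
      ∑ a ∈ slots G b with (slotGroup G a).1.Occupies r θ, (G.get a.2).2 := by
  rw [EvacNetwork.free_eq, h.sum_eq, Finset.sum_filter]
  rfl

open Classical in
theorem left_take_eq (G : N.RouteList) (n : ℕ) (r : V ⊕ E) :
    left (G.take n) r = N.cap r -
      ∑ l : Fin G.length with l.val < n ∧ ∃ t, (G.get l).1.Uses r t, (G.get l).2 := by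
  rw [left_eq, sum_map_take, ← Finset.filter_filter, Finset.sum_filter (fun l => ∃ t, _)]

/-- If an earlier path `l` uses `r`, its undelayed group that is at `r` at time `θ` arrives no later
than `y`, by `IsShortest.uses_le`. Its slot therefore precedes `b`, and its capacity is already
reserved. -/
theorem Follows.free_le_left (h : Follows G L b) (hG : IsGreedy rank G) {y : N.Trip}
    {r : V ⊕ E} {θ n : ℕ} (hy : y.Occupies r θ)
    (hcap : ∀ l : Fin G.length, l.val < n → 0 < routeCap (G.take l) y.route)
    (hb : ∀ l : Fin G.length, l.val < n → y.arrival < b.1 ∨ y.arrival = b.1 ∧ l < b.2) :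
    free L r θ ≤ left (G.take n) r := by
  classical
  rw [h.free_eq, left_take_eq]
  refine Nat.sub_le_sub_left ?_ _
  have key : ∀ l : Fin G.length, (l.val < n ∧ ∃ t, (G.get l).1.Uses r t) →
      ∃ σ, (σ, l) ∈ slots G b ∧ (slotGroup G (σ, l)).1.Occupies r θ := by
    rintro l ⟨hl, t, ht⟩
    obtain ⟨t', ht', h₁, h₂⟩ := hy.exists_uses
    obtain ⟨h₃, h₄⟩ := (hG l).1.uses_le (hcap l hl) ht ht'
    -- The subtraction is exact, since t ≤ t' ≤ θ.
    refine ⟨θ - t + (G.get l).1.transit, mem_slots.2 ⟨Nat.le_add_left _ _, ?_⟩,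
      Route.direct_occupies_iff.2 ⟨t, ht, ?_⟩⟩
    · have := hb l hl
      dsimp only
      omega
    · dsimp only
      omega
  choose! σ hσ using key
  calc ∑ l : Fin G.length with l.val < n ∧ ∃ t, (G.get l).1.Uses r t, (G.get l).2
      = ∑ a ∈ Finset.image (fun l => (σ l, l))
          {l : Fin G.length | l.val < n ∧ ∃ t, (G.get l).1.Uses r t}, (G.get a.2).2 := by
        rw [Finset.sum_image]
        intro l _ l' _ hll
        exact congrArg Prod.snd hll
    _ ≤ _ := by
        refine Finset.sum_le_sum_of_subset fun a ha => ?_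
        obtain ⟨l, hl, rfl⟩ := Finset.mem_image.1 ha
        exact Finset.mem_filter.2 (hσ l (Finset.mem_filter.1 hl).2)

/-- Slots whose groups occupy `r` at `θ` belong to distinct paths, by `Route.Uses.unique`. All these
paths precede `b.2` in `G`: by `IsShortest.uses_le`, a group on a later path would arrive no earlier
than `b.1`, so its slot would not precede `b`. -/
theorem Follows.left_le_free (h : Follows G L b) (hG : IsGreedy rank G) {r : V ⊕ E} {θ : ℕ}
    (hθ : (slotGroup G b).1.Occupies r θ) : left (G.take b.2) r ≤ free L r θ := by
  classical
  rw [h.free_eq, left_take_eq]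
  refine Nat.sub_le_sub_left ?_ _
  obtain ⟨t, ht, hθ⟩ := Route.direct_occupies_iff.1 hθ
  have hbT := h.transit_le
  have hinj : Set.InjOn Prod.snd
      ((slots G b).filter fun a => (slotGroup G a).1.Occupies r θ :
        Set (ℕ × Fin G.length)) := by
    rintro ⟨σ, l⟩ ha ⟨σ', l'⟩ ha' (rfl : l = l')
    obtain ⟨ha, ho⟩ := Finset.mem_filter.1 ha
    obtain ⟨ha', ho'⟩ := Finset.mem_filter.1 ha'
    obtain ⟨t₁, h₁, e₁⟩ := Route.direct_occupies_iff.1 ho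
    obtain ⟨t₂, h₂, e₂⟩ := Route.direct_occupies_iff.1 ho'
    have := h₁.unique h₂
    have := (mem_slots.1 ha).1
    have := (mem_slots.1 ha').1
    dsimp only at *
    congr 1
    omega
  rw [← Finset.sum_image (f := fun l => (G.get l).2) hinj]
  refine Finset.sum_le_sum_of_subset fun l hl => ?_
  obtain ⟨⟨σ, l⟩, ha, rfl⟩ := Finset.mem_image.1 hl
  obtain ⟨ha, ho⟩ := Finset.mem_filter.1 ha
  obtain ⟨t₁, h₁, e₁⟩ := Route.direct_occupies_iff.1 ho
  obtain ⟨hT, hlt⟩ := mem_slots.1 ha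
  refine Finset.mem_filter.2 ⟨Finset.mem_univ _, ?_, t₁, h₁⟩
  by_contra hle
  have := ((hG b.2).1.uses_le (routeCap_take_pos (not_lt.1 hle) (hG l).1.1) ht h₁).2
  dsimp only at *
  have : ¬ l < b.2 := hle
  omega

/-- The two bounds on free capacity meet along this journey, so the dynamic bottleneck equals the
static one. -/
theorem Follows.tripCap_slotGroup (h : Follows G L b) (hG : IsGreedy rank G) :
    tripCap L (slotGroup G b).1 = (slotGroup G b).2 := by
  have hfree : ∀ r θ, (slotGroup G b).1.Occupies r θ → free L r θ = left (G.take b.2) r := by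
    intro r θ ho
    refine le_antisymm (h.free_le_left hG ho ?_ fun l hl => .inr ⟨?_, hl⟩) (h.left_le_free hG ho)
    · exact fun l hl => routeCap_take_pos hl.le (hG b.2).1.1
    · rw [slotGroup, Route.direct_arrival]
      exact Nat.sub_add_cancel h.transit_le
  rw [tripCap_eq]
  refine Eq.trans ?_ (hG b.2).2.symm
  rw [routeCap_eq]
  congr 1
  ext c
  constructor
  · rintro ⟨r, θ, ho, rfl⟩
    obtain ⟨t, ht, -⟩ := Route.direct_occupies_iff.1 ho
    exact ⟨r, t, ht, hfree r θ ho⟩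
  · rintro ⟨r, t, ht, rfl⟩
    have ho : (slotGroup G b).1.Occupies r _ := Route.direct_occupies_iff.2 ⟨t, ht, rfl⟩
    exact ⟨r, _, ho, (hfree r _ ho).symm⟩

/-- A journey that is available after the slots before `b` avoids the nodes and edges saturated by
the paths whose slots for its arrival time precede `b`. -/
theorem Follows.routeCap_pos (h : Follows G L b) (hG : IsGreedy rank G) {y : N.Trip}
    (hy : 0 < tripCap L y) {n : ℕ} (hn : n ≤ G.length)
    (hb : ∀ l : Fin G.length, l.val < n → y.arrival < b.1 ∨ y.arrival = b.1 ∧ l < b.2) :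
    0 < routeCap (G.take n) y.route := by
  induction n with
  | zero => simpa using routeCap_nil_pos_of_tripCap_pos hy
  | succ n ih =>
    have ih := ih (by omega) fun l hl => hb l (by omega)
    refine routeCap_pos_iff.2 fun r t hr => ?_
    obtain ⟨θ, ho⟩ := Trip.exists_occupies hr
    exact (free_pos_of_tripCap_pos hy ho).trans_le
      (h.free_le_left hG ho (fun l hl => routeCap_take_pos (Nat.lt_succ_iff.1 hl) ih) hb)

theorem Follows.arrival_slotGroup (h : Follows G L b) : (slotGroup G b).1.arrival = b.1 := by
  rw [slotGroup, Route.direct_arrival]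
  exact Nat.sub_add_cancel h.transit_le

/-- After the slots before `b`, CCRP can only choose the journey of the slot `b`. -/
theorem Follows.isCCRPChoice_iff (h : Follows G L b) (hG : IsGreedy rank G)
    (hc : ¬ ∃ P : N.Route, 0 < routeCap G P) (hrank : Function.Injective rank) {x : N.Trip} :
    IsCCRPChoice rank L x ↔ x = (slotGroup G b).1 := by
  have hpos : 0 < tripCap L (slotGroup G b).1 :=
    h.tripCap_slotGroup hG ▸ hG.cap_pos b.2
  have harr := h.arrival_slotGroup
  have hstart : (slotGroup G b).1.start = b.1 - (G.get b.2).1.transit := Route.direct_start _ _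
  have hT := h.transit_le
  have hmin : ∀ y : N.Trip, 0 < tripCap L y →
      tripKey rank (slotGroup G b).1 ≤ tripKey rank y := by
    intro y hy
    simp only [tripKey, Prod.Lex.toLex_le_toLex, harr]
    rcases lt_trichotomy y.arrival b.1 with hlt | heq | hlt
    -- An earlier arrival would need a path surviving all of `G`, but `G` is complete.
    · have := h.routeCap_pos hG hy le_rfl fun _ _ => .inl hlt
      rw [List.take_length] at this
      exact absurd ⟨_, this⟩ hc
    · refine .inr ⟨heq.symm, ?_⟩
      have hcap := h.routeCap_pos hG hy b.2.2.le fun l hl => .inr ⟨heq, hl⟩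
      rcases ((hG b.2).1.2 _ hcap).lt_or_eq with hk | hk
      · exact .inl hk
      · refine .inr ⟨hk, ?_⟩
        have h₁ := y.start_add_transit_le
        have h₂ : (G.get b.2).1.transit = y.route.transit :=
          congrArg (fun k => (ofLex k).1) hk
        omega
    · exact .inl hlt
  constructor
  · intro hx
    -- Equal keys fix the arrival, the path (`rank` is injective) and the duration; the latter
    -- equals the transit time, so there is no delay.
    have hkey := le_antisymm (hx.2 _ hpos) (hmin x hx.1)
    have h₁ : x.arrival = (slotGroup G b).1.arrival := congrArg (fun k => (ofLex k).1) hkey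
    have h₂ : rank x.route = rank (G.get b.2).1 :=
      congrArg (fun k => (ofLex (ofLex (ofLex k).2).1).2) hkey
    have h₃ : x.arrival - x.start = (slotGroup G b).1.arrival - (slotGroup G b).1.start :=
      congrArg (fun k => (ofLex (ofLex k).2).2) hkey
    have hr := hrank h₂
    have h₄ := x.start_add_transit_le
    have h₅ := congrArg Route.transit hr
    rw [x.eq_direct (by omega), slotGroup, hr]
    congr 1
    omega
  · rintro rfl
    exact ⟨hpos, hmin⟩

/-- After the slot `b` the next one is due. -/
theorem Follows.exists_next (h : Follows G L b) :
    ∃ b', Follows G (L ++ [slotGroup G b]) b' := by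
  have hT := h.transit_le
  -- The next slot is the lexicographic minimum of the later ones; the same path one time unit later
  -- shows that there are some.
  obtain ⟨b', ⟨hb'T, hbb'⟩, hmin⟩ :=
    (InvImage.wf (toLex : ℕ × Fin G.length → ℕ ×ₗ Fin G.length) wellFounded_lt).has_min
      {a | (G.get a.2).1.transit ≤ a.1 ∧ (b.1 < a.1 ∨ b.1 = a.1 ∧ b.2 < a.2)}
      ⟨(b.1 + 1, b.2), by dsimp only; omega, .inl (Nat.lt_succ_self _)⟩
  have hslots : slots G b' = insert b (slots G b) := by
    ext a
    rw [Finset.mem_insert, mem_slots, mem_slots]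
    constructor
    · rintro ⟨haT, hab'⟩
      by_contra hcon
      push Not at hcon
      obtain ⟨hne, hnlt⟩ := hcon
      have hnlt := hnlt haT
      have hne : ¬ (a.1 = b.1 ∧ a.2 = b.2) := fun h => hne (Prod.ext h.1 h.2)
      refine hmin a ⟨haT, ?_⟩ (Prod.Lex.toLex_lt_toLex.2 hab')
      omega
    · rintro (rfl | ⟨haT, hab⟩)
      · exact ⟨hT, hbb'⟩
      · exact ⟨haT, by omega⟩
  refine ⟨b', hb'T, fun g => ?_⟩
  rw [hslots, Finset.sum_insert (by simp [mem_slots]), List.map_append, List.sum_append, h.sum_eq]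
  simp [add_comm]

/-- The first path has the least transit time, so no slot precedes its first one. -/
theorem IsGreedy.follows_nil (hG : IsGreedy rank G) (hne : 0 < G.length) :
    Follows G [] ((G.get ⟨0, hne⟩).1.transit, ⟨0, hne⟩) := by
  refine ⟨le_rfl, fun g => ?_⟩
  have : slots G ((G.get ⟨0, hne⟩).1.transit, ⟨0, hne⟩) = ∅ := by
    refine Finset.eq_empty_of_forall_notMem fun a ha => ?_
    obtain ⟨haT, h⟩ := mem_slots.1 ha
    have := hG.transit_mono (i := ⟨0, hne⟩) (j := a.2) (Nat.zero_le _)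
    simp only [Fin.lt_def] at h
    omega
  rw [this]
  rfl

theorem Plan.people_append (L : N.Plan) (x : N.Trip) (c : ℕ) :
    Plan.people (L ++ [(x, c)]) = L.people + c := by
  simp [Plan.people]

/-- While there are people left, CCRP fills the slots one after the other. -/
theorem CCRPReaches.exists_follows {p : ℕ} (hL : CCRPReaches rank p L) (hG : IsGreedy rank G)
    (hc : ¬ ∃ P : N.Route, 0 < routeCap G P) (hrank : Function.Injective rank)
    (hne : 0 < G.length) (hp : L.people < p) : ∃ b, Follows G L b := by
  induction hL with
  | init => exact ⟨_, hG.follows_nil hne⟩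
  | reserve L x hL hp' hx ih =>
    obtain ⟨b, hb⟩ := ih hp'
    obtain rfl := (hb.isCCRPChoice_iff hG hc hrank).1 hx
    rw [Plan.people_append] at hp
    -- People remain after this reservation, so the group was not cut short and fills its slot.
    rw [min_eq_right (by omega), hb.tripCap_slotGroup hG]
    exact hb.exists_next

theorem CCRPReaches.people_le {p : ℕ} (hL : CCRPReaches rank p L) : L.people ≤ p := by
  cases hL with
  | init => exact Nat.zero_le _
  | reserve L x hL hp' hx =>
    rw [Plan.people_append]
    omega

/-- CCRP terminates. -/
theorem IsGreedy.exists_isCCRPSolution (hG : IsGreedy rank G)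
    (hc : ¬ ∃ P : N.Route, 0 < routeCap G P) (hrank : Function.Injective rank)
    (hne : 0 < G.length) (p : ℕ) : ∃ L : N.Plan, IsCCRPSolution rank p L := by
  suffices ∀ (n : ℕ) (L : N.Plan), CCRPReaches rank p L → p - L.people = n →
      ∃ L : N.Plan, IsCCRPSolution rank p L from this _ _ .init rfl
  intro n
  induction n using Nat.strong_induction_on with
  | _ n ih =>
  intro L hL hn
  rcases hL.people_le.lt_or_eq with hlt | heq
  · obtain ⟨b, hb⟩ := hL.exists_follows hG hc hrank hne hlt
    have hx := (hb.isCCRPChoice_iff hG hc hrank).2 rfl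
    refine ih _ ?_ _ (.reserve L _ hL hlt hx) rfl
    have := hx.1
    rw [Plan.people_append]
    omega
  · exact ⟨L, hL, heq⟩

/-! ### Counting the people sent by CCRP -/

theorem Plan.evacTime_le_iff {L : N.Plan} {z : ℕ} :
    L.evacTime ≤ z ↔ ∀ q ∈ L, q.1.arrival ≤ z := by
  induction L with
  | nil => simp [Plan.evacTime]
  | cons q L ih =>
    rw [List.forall_mem_cons, ← ih]
    simp [Plan.evacTime]

/-- The people in the slots up to `b` can be counted path by path. -/
theorem Follows.people_add_le (h : Follows G L b) : L.people + (G.get b.2).2 ≤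
    (G.map fun q => q.2 * (b.1 + 1 - q.1.transit)).sum := by
  have hb : b ∉ slots G b := by simp [mem_slots]
  have hT := h.transit_le
  -- A path has one slot for each arrival time from its transit time to `b.1`; truncated subtraction
  -- gives 0 if it is too long.
  have e : (G.map fun q => q.2 * (b.1 + 1 - q.1.transit)).sum =
      ∑ a ∈ Finset.range (b.1 + 1) ×ˢ Finset.univ with (G.get a.2).1.transit ≤ a.1,
        (G.get a.2).2 := by
    rw [Finset.sum_filter, Finset.sum_product_right]
    have hs := sum_map_take G (fun q => q.2 * (b.1 + 1 - q.1.transit)) G.length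
    rw [List.take_length, Finset.filter_true_of_mem fun l _ => l.2] at hs
    rw [hs]
    refine Finset.sum_congr rfl fun l _ => ?_
    have hI : ((Finset.range (b.1 + 1)).filter fun σ => (G.get l).1.transit ≤ σ) =
        Finset.Ico (G.get l).1.transit (b.1 + 1) := by
      ext σ
      simp only [Finset.mem_filter, Finset.mem_range, Finset.mem_Ico]
      omega
    dsimp only
    rw [← Finset.sum_filter, hI, Finset.sum_const, Nat.card_Ico, smul_eq_mul, mul_comm]
  rw [e, Plan.people, h.sum_eq, add_comm]
  have := Finset.sum_insert (f := fun a => (G.get a.2).2) hb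
  refine this.symm.trans_le (Finset.sum_le_sum_of_subset fun a ha => ?_)
  rw [Finset.mem_insert, mem_slots] at ha
  simp only [Finset.mem_filter, Finset.mem_product, Finset.mem_range, Finset.mem_univ, and_true]
  rcases ha with rfl | ha <;> omega

theorem IsCCRPSolution.le_sum {p : ℕ} (hL : IsCCRPSolution rank p L) (hp : 0 < p)
    (hG : IsGreedy rank G) (hc : ¬ ∃ P : N.Route, 0 < routeCap G P)
    (hrank : Function.Injective rank) (hne : 0 < G.length) :
    p ≤ (G.map fun q => q.2 * (L.evacTime + 1 - q.1.transit)).sum := by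
  obtain ⟨hL, hpeople⟩ := hL
  cases hL with
  | init => simp [Plan.people] at hpeople; omega
  | reserve L x hL hp' hx =>
    obtain ⟨b, hb⟩ := hL.exists_follows hG hc hrank hne hp'
    obtain rfl := (hb.isCCRPChoice_iff hG hc hrank).1 hx
    rw [Plan.people_append, hb.tripCap_slotGroup hG] at hpeople
    have hle := Plan.evacTime_le_iff.1 (le_refl (Plan.evacTime
      (L ++ [((slotGroup G b).1, min (p - L.people) (tripCap L (slotGroup G b).1))])))
      _ (List.mem_append_right _ (List.mem_singleton_self _))
    rw [hb.arrival_slotGroup] at hle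
    -- The final group may be smaller than its slot, so only an inequality holds.
    have h₁ : p ≤ L.people + (G.get b.2).2 := by
      rw [← hpeople]
      exact Nat.add_le_add_left (min_le_right _ _) _
    refine (h₁.trans (hb.people_add_le)).trans (List.sum_le_sum fun q _ => ?_)
    gcongr

end

/-! ### The combined evacuation time -/

/-- Clearing the denominator turns the ceiling into a linear condition. Integer subtraction is not
truncated: paths with T > z + 1 count negatively. -/
theorem cet_le_iff {p : ℕ} {R : N.RouteList} (hne : R ≠ []) (hpos : ∀ q ∈ R, 0 < q.2) {z : ℤ} :
    cet p R ≤ z ↔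
      (p : ℤ) ≤ (R.map fun q => (q.2 : ℤ) * (z + 1 - q.1.transit)).sum := by
  have hsum : 0 < (R.map fun q => (q.2 : ℚ)).sum := by
    refine List.sum_pos _ ?_ (by simpa using hne)
    intro c hc
    obtain ⟨q, hq, rfl⟩ := List.mem_map.1 hc
    exact_mod_cast hpos q hq
  have hcast : (((R.map fun q => (q.2 : ℤ) * (z + 1 - q.1.transit)).sum : ℤ) : ℚ) =
      (z + 1) * (R.map fun q => (q.2 : ℚ)).sum -
        (R.map fun q => (q.2 : ℚ) * q.1.transit).sum := by
    clear hsum hne hpos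
    induction R with
    | nil => simp
    | cons q R ih =>
      simp only [List.map_cons, List.sum_cons, Int.cast_add, ih]
      push_cast
      ring
  rw [cet, sub_le_iff_le_add, Int.ceil_le, div_le_iff₀ hsum, ← Int.cast_le (R := ℚ), hcast,
    le_sub_iff_add_le]
  push_cast
  rfl

theorem SSEPReaches.isGreedy {rank : N.Route → ℕ} {p : ℕ} {R : N.RouteList}
    (hR : SSEPReaches rank p R) : IsGreedy rank R := by
  induction hR with
  | init => exact isGreedy_nil rank
  | add R P hR hp hP hT ih => exact ih.snoc hP

theorem IsGreedy.cap_pos_of_mem {rank : N.Route → ℕ} {G : N.RouteList} (hG : IsGreedy rank G)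
    {q : N.Route × ℕ} (hq : q ∈ G) : 0 < q.2 := by
  obtain ⟨i, rfl⟩ := List.get_of_mem hq
  exact hG.cap_pos i

/-- No path is added whose transit time exceeds the resulting combined evacuation time. -/
theorem SSEPReaches.transit_le_cet {rank : N.Route → ℕ} {p : ℕ} (hp : 0 < p)
    {R : N.RouteList} (hR : SSEPReaches rank p R) {q : N.Route × ℕ} (hq : q ∈ R) :
    (q.1.transit : ℤ) ≤ cet p R := by
  have hG := hR.isGreedy
  cases hR with
  | init => simp at hq
  | add R P hR _ hP hT =>
    have h₁ : q.1.transit ≤ P.transit := by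
      obtain ⟨i, rfl⟩ := List.get_of_mem hq
      have hi : i ≤ (⟨R.length, by simp⟩ : Fin (R ++ [(P, routeCap R P)]).length) := by
        have := i.2.trans_eq (List.length_append ..)
        exact Nat.lt_succ_iff.1 this
      simpa using hG.transit_mono hi
    suffices (P.transit : ℤ) ≤ cet p (R ++ [(P, routeCap R P)]) by omega
    by_contra hlt
    -- At z = T(P) - 1 the new path contributes 0, so the inequality already holds for the old list,
    -- against the test that admitted `P`.
    have h₂ := (cet_le_iff (by simp) fun q hq => hG.cap_pos_of_mem hq).1
      (Int.le_sub_one_of_lt (not_le.1 hlt))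
    simp only [List.map_append, List.sum_append, List.map_cons, List.map_nil,
      List.sum_singleton, sub_add_cancel, sub_self, mul_zero, add_zero] at h₂
    rcases eq_or_ne R [] with rfl | hne
    · simp at h₂
      omega
    · have h₃ := (cet_le_iff (z := P.transit - 1) hne fun q hq => hR.isGreedy.cap_pos_of_mem hq).2
        (by simpa using h₂)
      have := hT.resolve_left hne
      omega

/-! ### Termination of SSEP and the evacuation time of its plan -/

theorem SSEPStops.ne_nil {rank : N.Route → ℕ} {p : ℕ} {R : N.RouteList}
    (h : SSEPStops rank p R) (hp : 0 < p) (hreach : ∃ P : N.Route, 0 < routeCap [] P) :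
    R ≠ [] := by
  rintro rfl
  rcases h with h | h | ⟨P, -, h, -⟩
  · simp at h
    omega
  · exact h hreach
  · exact h rfl

theorem exists_ssepReaches_stops (rank : N.Route → ℕ) (p : ℕ) :
    ∃ R, SSEPReaches rank p R ∧ SSEPStops rank p R := by
  suffices ∀ (n : ℕ) (R : N.RouteList), SSEPReaches rank p R → p - R.length = n →
      ∃ R, SSEPReaches rank p R ∧ SSEPStops rank p R from this _ _ .init rfl
  intro n
  induction n using Nat.strong_induction_on with
  | _ n ih =>
  intro R hR hn
  by_cases hs : SSEPStops rank p R
  · exact ⟨R, hR, hs⟩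
  · simp only [SSEPStops, not_or, not_le, not_exists, not_and, not_forall, not_not] at hs
    obtain ⟨hlen, hex, hT⟩ := hs
    obtain ⟨P, hP⟩ := exists_isShortest rank hex
    refine ih _ ?_ _ (.add R P hR hlen hP ?_) rfl
    · rw [List.length_append, List.length_singleton]
      omega
    · by_cases hne : R = []
      · exact .inl hne
      · exact .inr (not_lt.1 (hT P hP hne))

theorem numGroups_le_iff {x c n : ℕ} (hc : 0 < c) : numGroups x c ≤ n ↔ x ≤ c * n := by
  rw [numGroups, Nat.ceil_le, div_le_iff₀ (by exact_mod_cast hc), mul_comm c n]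
  exact_mod_cast Iff.rfl

theorem exists_le_sum_eq {ι : Type*} [Fintype ι] (U : ι → ℕ) {p : ℕ} (hp : p ≤ ∑ i, U i) :
    ∃ x : ι → ℕ, (∀ i, x i ≤ U i) ∧ ∑ i, x i = p := by
  classical
  induction p with
  | zero => exact ⟨0, by simp⟩
  | succ p ih =>
    obtain ⟨x, hx, hsum⟩ := ih (by omega)
    obtain ⟨i, hi⟩ : ∃ i, x i < U i := by
      by_contra hcon
      push Not at hcon
      have := Finset.sum_le_sum fun i (_ : i ∈ Finset.univ) => hcon i
      omega
    refine ⟨Function.update x i (x i + 1), fun j => ?_, ?_⟩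
    · rcases eq_or_ne j i with rfl | hj
      · simpa using hi
      · simpa [hj] using hx j
    · rw [Finset.sum_update_of_mem (Finset.mem_univ i), ← hsum,
        ← Finset.add_sum_erase _ _ (Finset.mem_univ i), Finset.sdiff_singleton_eq_erase]
      omega

theorem sum_map_eq_sum_fin {α M : Type*} [AddCommMonoid M] (R : List α) (f : α → M) :
    (R.map f).sum = ∑ i : Fin R.length, f (R.get i) := by
  rw [← List.sum_ofFn]
  exact congrArg List.sum (List.ofFn_getElem_eq_map R f).symm

/-- SSEP terminates with a solution. -/
theorem exists_isSSEPSolution (rank : N.Route → ℕ) {p : ℕ} (hp : 0 < p)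
    (hreach : ∃ P : N.Route, 0 < routeCap [] P) :
    ∃ (R : N.RouteList) (x : Fin R.length → ℕ), IsSSEPSolution rank p R x := by
  obtain ⟨R, hR, hs⟩ := exists_ssepReaches_stops (N := N) rank p
  have hne := hs.ne_nil hp hreach
  have hG := hR.isGreedy
  have hT : ∀ i : Fin R.length, ((R.get i).1.transit : ℤ) ≤ cet p R :=
    fun i => hR.transit_le_cet hp (List.get_mem R i)
  have hle := (cet_le_iff hne fun q hq => hG.cap_pos_of_mem hq).1 (le_refl (cet p R))
  rw [sum_map_eq_sum_fin] at hle
  -- The bound is the number of people that a path can deliver by time CET; `cet_le_iff` at z = CET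
  -- says that these bounds suffice.
  obtain ⟨x, hx, hsum⟩ := exists_le_sum_eq (p := p)
    (fun i : Fin R.length => (R.get i).2 * (cet p R + 1 - (R.get i).1.transit).toNat) (by
      zify
      refine hle.trans_eq (Finset.sum_congr rfl fun i _ => ?_)
      rw [Int.toNat_of_nonneg (by have := hT i; omega)])
  refine ⟨R, x, hR, hs, hsum, fun i => ?_⟩
  have := (numGroups_le_iff (hG.cap_pos i)).2 (hx i)
  have := hT i
  omega

theorem IsSSEPSolution.evacTime_eq {rank : N.Route → ℕ} {p : ℕ} (hp : 0 < p)
    (hreach : ∃ P : N.Route, 0 < routeCap [] P) {R : N.RouteList} {x : Fin R.length → ℕ}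
    (h : IsSSEPSolution rank p R x) : ((ssepPlan R x).evacTime : ℤ) = cet p R := by
  have hne := h.stops.ne_nil hp hreach
  have hG := h.reaches.isGreedy
  have hT : ∀ i : Fin R.length, ((R.get i).1.transit : ℤ) ≤ cet p R :=
    fun i => h.reaches.transit_le_cet hp (List.get_mem R i)
  have hcet : 0 ≤ cet p R := (Int.natCast_nonneg _).trans (hT ⟨0, List.length_pos_of_ne_nil hne⟩)
  refine le_antisymm ?_ ?_
  · suffices (ssepPlan R x).evacTime ≤ (cet p R).toNat by omega
    refine Plan.evacTime_le_iff.2 fun q hq => ?_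
    simp only [ssepPlan, List.mem_flatMap, List.mem_map, List.mem_range] at hq
    obtain ⟨i, -, j, hj, rfl⟩ := hq
    have := h.time_le i
    rw [Route.direct_arrival]
    omega
  · by_contra hlt
    rw [not_le] at hlt
    -- If everybody arrived by CET - 1, the paths could carry `p` people by then, contradicting the
    -- minimality of CET.
    have key : (p : ℤ) ≤
        (R.map fun q => (q.2 : ℤ) * (cet p R - 1 + 1 - q.1.transit)).sum := by
      have hp' : (p : ℤ) = ∑ i, (x i : ℤ) := by exact_mod_cast h.sum_eq.symm
      rw [sum_map_eq_sum_fin]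
      refine hp'.trans_le ?_
      refine Finset.sum_le_sum fun i _ => ?_
      have hn : numGroups (x i) (R.get i).2 ≤ (cet p R - (R.get i).1.transit).toNat := by
        rcases Nat.eq_zero_or_pos (numGroups (x i) (R.get i).2) with h0 | h0
        · omega
        -- The last group on the path leaves at time `numGroups - 1`.
        · have := Plan.evacTime_le_iff.1 (le_refl (ssepPlan R x).evacTime) _
            (List.mem_flatMap.2 ⟨i, List.mem_finRange i, List.mem_map.2
              ⟨numGroups (x i) (R.get i).2 - 1, List.mem_range.2 (by omega), rfl⟩⟩)
          rw [Route.direct_arrival] at this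
          omega
      have hx := (numGroups_le_iff (hG.cap_pos i)).1 hn
      zify at hx
      rw [Int.toNat_of_nonneg (by have := hT i; omega)] at hx
      rw [sub_add_cancel]
      exact hx
    have := (cet_le_iff hne fun q hq => hG.cap_pos_of_mem hq).2 key
    omega

/-- When SSEP stops, no later path of a greedy list is shorter than the combined evacuation
time. -/
theorem SSEPStops.cet_le_transit {rank : N.Route → ℕ} {p : ℕ} {R R' : N.RouteList}
    (hs : SSEPStops rank p R) (hne : R ≠ []) (hG : IsGreedy rank (R ++ R'))
    (hR : IsGreedy rank R) {q : N.Route × ℕ} (hq : q ∈ R') : cet p R ≤ q.1.transit := by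
  obtain ⟨i, rfl⟩ := List.get_of_mem hq
  have hlen : R.length + i < (R ++ R').length := by
    rw [List.length_append]
    omega
  have hget : (R ++ R').get ⟨R.length + i, hlen⟩ = R'.get i := by simp
  have hcap : 0 < routeCap R (R'.get i).1 := by
    have := routeCap_take_pos (Nat.le_add_right R.length i) (hG ⟨R.length + i, hlen⟩).1.1
    rwa [hget, List.take_left] at this
  rcases hs with h | h | ⟨P, hP, -, h⟩
  -- With at least `p` paths, none longer than the later one, each delivers at least one person by
  -- the transit time of the latter.
  · refine (cet_le_iff hne fun q hq => hR.cap_pos_of_mem hq).2 ?_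
    rw [sum_map_eq_sum_fin]
    calc (p : ℤ) ≤ ∑ _j : Fin R.length, (1 : ℤ) := by simpa using h
      _ ≤ _ := by
        refine Finset.sum_le_sum fun j _ => ?_
        have h₁ : 0 < (R.get j).2 := hR.cap_pos j
        have h₂ : (R.get j).1.transit ≤ (R'.get i).1.transit := by
          refine (hR j).1.transit_le ?_
          have := routeCap_take_pos (G := R) (n := R.length) j.2.le (P := (R'.get i).1)
          rw [List.take_length] at this
          exact this hcap
        have h₃ : (1 : ℤ) ≤ (R.get j).2 := by exact_mod_cast h₁
        have h₄ : (1 : ℤ) ≤ (R'.get i).1.transit + 1 - (R.get j).1.transit := by omega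
        exact one_le_mul_of_one_le_of_one_le h₃ h₄
  · exact absurd ⟨_, hcap⟩ h
  · have := hP.transit_le hcap
    omega

/-! ### Comparison of SSEP with CCRP -/

theorem IsSSEPSolution.cet_le_evacTime {rank : N.Route → ℕ} (hrank : Function.Injective rank)
    {p : ℕ} (hp : 0 < p) (hreach : ∃ P : N.Route, 0 < routeCap [] P) {R : N.RouteList}
    {x : Fin R.length → ℕ} (h : IsSSEPSolution rank p R x) {L : N.Plan}
    (hL : IsCCRPSolution rank p L) : cet p R ≤ L.evacTime := by
  have hne := h.stops.ne_nil hp hreach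
  have hR := h.reaches.isGreedy
  obtain ⟨_, ⟨R', rfl⟩, hG, hc⟩ := hR.exists_complete
  have hlen : 0 < (R ++ R').length := by
    have := List.length_pos_of_ne_nil hne
    rw [List.length_append]
    omega
  have hle := hL.le_sum hp hG hc hrank hlen
  by_contra hlt
  rw [not_le] at hlt
  -- Paths beyond those of SSEP have transit time at least CET, so they deliver nobody before CET.
  have hzero : (R'.map fun q => q.2 * (L.evacTime + 1 - q.1.transit)).sum = 0 := by
    refine List.sum_eq_zero fun c hc => ?_
    obtain ⟨q, hq, rfl⟩ := List.mem_map.1 hc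
    have := h.stops.cet_le_transit hne hG hR hq
    rw [Nat.sub_eq_zero_of_le (by omega), mul_zero]
  rw [List.map_append, List.sum_append, hzero, add_zero, sum_map_eq_sum_fin] at hle
  -- Since T ≤ CET on `R`, the term CET - T is nonnegative and dominates the truncated one.
  have := (cet_le_iff (z := cet p R - 1) hne fun q hq => hR.cap_pos_of_mem hq).2 (by
    rw [sum_map_eq_sum_fin]
    refine (Int.ofNat_le.2 hle).trans ?_
    push_cast
    refine Finset.sum_le_sum fun i _ => ?_
    have hT := h.reaches.transit_le_cet hp (List.get_mem R i)
    refine mul_le_mul_of_nonneg_left ?_ (Int.natCast_nonneg _)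
    omega)
  omega

theorem routeCap_nil_pos {P : N.Route} (hn : ∀ i, 0 < N.nodeCap (P.node i))
    (he : ∀ i, 0 < N.edgeCap (P.edge i)) : 0 < routeCap [] P :=
  routeCap_pos_iff_forall.2 ⟨fun i => by simpa [nodeLeft] using hn i,
    fun i => by simpa [edgeLeft] using he i⟩

end EvacNetwork

theorem mainTheorem1 {V E : Type*} [Finite V] [Finite E] (N : EvacNetwork V E)
    (rank : N.Route → ℕ) (hrank : Function.Injective rank)
    (p : ℕ) (hp : 0 < p)
    (hreach : ∃ P : N.Route, (∀ i, 0 < N.nodeCap (P.node i)) ∧ ∀ i, 0 < N.edgeCap (P.edge i)) :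
    (∃ (R : N.RouteList) (x : Fin R.length → ℕ), EvacNetwork.IsSSEPSolution rank p R x) ∧
    (∃ L : N.Plan, EvacNetwork.IsCCRPSolution rank p L) ∧
    ∀ (R : N.RouteList) (x : Fin R.length → ℕ) (L : N.Plan),
      EvacNetwork.IsSSEPSolution rank p R x → EvacNetwork.IsCCRPSolution rank p L →
        ((EvacNetwork.ssepPlan R x).evacTime : ℤ) = EvacNetwork.cet p R ∧
        (EvacNetwork.ssepPlan R x).evacTime ≤ L.evacTime := by
  have hreach' : ∃ P : N.Route, 0 < EvacNetwork.routeCap [] P :=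
    hreach.imp fun P hP => EvacNetwork.routeCap_nil_pos hP.1 hP.2
  refine ⟨EvacNetwork.exists_isSSEPSolution rank hp hreach', ?_, fun R x L hR hL => ?_⟩
  · obtain ⟨G, -, hG, hc⟩ := (EvacNetwork.isGreedy_nil rank).exists_complete
    refine hG.exists_isCCRPSolution hc hrank (List.length_pos_of_ne_nil ?_) p
    rintro rfl
    exact hc hreach'
  · have h₁ := hR.evacTime_eq hp hreach'
    have h₂ := hR.cet_le_evacTime hrank hp hreach' hL
    exact ⟨h₁, by omega⟩
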